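/- Let $G=(\mathcal V,\mathcal A)$ be a finite directed graph with arc costs $c_a\ge 0$ and a set $\mathcal A_1\subseteq\mathcal A$ of tolled arcs, the other arcs being toll-free. Let $\mathcal K$ be a finite set of commodities, each with an origin $o^k$ and a destination $d^k$, such that there is a path of toll-free arcs from $o^k$ to $d^k$. Let $A$ be the node-arc incidence matrix of $G$ and let $b^k=e_{o^k}-e_{d^k}$ be the source-sink vector of $k$. For $t\in\mathbb R^{\mathcal A_1}$ with $t\ge 0$ put $$f(t)=\min_{w,(x^k)}\Bigl\{\sum_{k}c^{\top}x^k+t^{\top}w \;\Bigm|\; \sum_k x^k_{\mathcal A_1}\le w,\ Ax^k=b^k\ \forall k,\ w\ge 0,\ x^k\ge 0\ \forall k\Bigr\},$$ put $f(t)=-\infty$ if $t\not\ge 0$, and let $g(w)=\sup_{t}\{f(t)-t^{\top}w\}\in\mathbb R\cup\{+\infty\}$ for $w\in\mathbb R^{\mathcal A_1}$. Let $f^k$ and $g^k$ be the same functions for the problem whose only commodity is $k$. A *reaction set* is a set of the form $\{w\mid (w,z)\in F\text{ for some }z\}$, where $F$ is a face of the epigraph $\operatorname{epi}(g)$ that is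 non-vertical, i.e. $(0,1)$ is not a direction of the affine hull of $F$. A vector $w$ is *strongly bilevel feasible* if $\{w\}$ is a reaction set; it is strongly bilevel feasible *individually* for commodity $k$ if this holds with $g^k$ in place of $g$. A *bilevel feasible decomposition* of $w$ is a family $(w^k)_{k\in\mathcal K}$ of vectors of $\mathbb R^{\mathcal A_1}$ with $\sum_k w^k=w$ and $\sum_k g^k(w^k)=g(w)$. **Theorem.** A reduced reaction $w\in\mathbb R^{\mathcal A_1}$, $w\ge 0$, is strongly bilevel feasible if and only if both of the following conditions hold: 1. there exists exactly one bilevel feasible decomposition $(w^k)$ of $w$; 2. in this unique decomposition $(w^k)$, each $w^k$ is strongly bilevel feasible individually for commodity $k$. -/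

import Mathlib

open scoped Matrix

/-- A finite directed network with a set of tolled arcs and nonnegative base costs. Every arc `a`
goes from `src a` to `tgt a`; the arcs outside `tolled` are toll-free. -/
structure TollNetwork (V A : Type*) where
  src : A → V
  tgt : A → V
  tolled : Finset A
  cost : A → ℝ
  cost_nonneg : ∀ a, 0 ≤ cost a

namespace TollNetwork

/-- There is a directed path from `u` to `v` that uses toll-free arcs only. -/
def HasTollFreePath {V A : Type*} (N : TollNetwork V A) (u v : V) : Prop :=
  Relation.ReflTransGen (fun p q => ∃ a, a ∉ N.tolled ∧ N.src a = p ∧ N.tgt a = q) u v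

/-- The node-arc incidence matrix: `+1` at the tail of an arc, `-1` at its head. -/
def incidence {V A : Type*} [DecidableEq V] (N : TollNetwork V A) : Matrix V A ℝ :=
  fun v a => (if N.src a = v then 1 else 0) - (if N.tgt a = v then 1 else 0)

/-- The source-sink vector of an origin-destination pair. -/
def sourceSink {V : Type*} [DecidableEq V] (u v : V) : V → ℝ :=
  Pi.single u 1 - Pi.single v 1

/-- The feasible compositions `(x^k)`: each `x^k` is a nonnegative flow of one unit from `o k`
to `d k`. -/
def reactions {V A K : Type*} [DecidableEq V] [Fintype A] (N : TollNetwork V A) (o d : K → V) :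
    Set (K → A → ℝ) :=
  {x | ∀ k, N.incidence *ᵥ x k = sourceSink (o k) (d k) ∧ 0 ≤ x k}

/-- The feasible points `(w, (x^k))` of the aggregated follower's problem. -/
def aggregatedFeasible {V A K : Type*} [DecidableEq V] [Fintype A] [Fintype K]
    (N : TollNetwork V A) (o d : K → V) : Set ((N.tolled → ℝ) × (K → A → ℝ)) :=
  {p | 0 ≤ p.1 ∧ p.2 ∈ N.reactions o d ∧ ∀ a : N.tolled, ∑ k, p.2 k a ≤ p.1 a}

open Classical in
/-- The followers' total cost `f(t)`: the optimal value of the aggregated follower's problem if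
`t ≥ 0`, and `-∞` otherwise. -/
noncomputable def followerCost {V A K : Type*} [DecidableEq V] [Fintype A] [Fintype K]
    (N : TollNetwork V A) (o d : K → V) (t : N.tolled → ℝ) : EReal :=
  if 0 ≤ t then
    ⨅ p ∈ N.aggregatedFeasible o d, (((∑ k, N.cost ⬝ᵥ p.2 k) + t ⬝ᵥ p.1 : ℝ) : EReal)
  else ⊥

/-- The conjugate `g(w) = sup_t (f(t) - tᵀw)`, with values in the extended reals. -/
noncomputable def conjugateCost {V A K : Type*} [DecidableEq V] [Fintype A] [Fintype K]
    (N : TollNetwork V A) (o d : K → V) (w : N.tolled → ℝ) : EReal :=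
  ⨆ t : N.tolled → ℝ, (N.followerCost o d t - ((t ⬝ᵥ w : ℝ) : EReal))

/-- The function `g^k`: the conjugate for the problem whose only commodity is `k`. -/
noncomputable def conjugateCostOf {V A K : Type*} [DecidableEq V] [Fintype A]
    (N : TollNetwork V A) (o d : K → V) (k : K) (w : N.tolled → ℝ) : EReal :=
  N.conjugateCost (fun _ : Unit => o k) (fun _ : Unit => d k) w

/-- The epigraph of `g`. -/
def epigraph {V A K : Type*} [DecidableEq V] [Fintype A] [Fintype K]
    (N : TollNetwork V A) (o d : K → V) : Set ((N.tolled → ℝ) × ℝ) :=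
  {p | N.conjugateCost o d p.1 ≤ (p.2 : EReal)}

/-- `W` is a reaction set: the projection to the `w`-space of a face `F` (a convex extreme subset)
of the epigraph of `g` that is non-vertical, i.e. the vertical direction is not a direction of the
affine hull of `F`. -/
def IsReactionSet {V A K : Type*} [DecidableEq V] [Fintype A] [Fintype K]
    (N : TollNetwork V A) (o d : K → V) (W : Set (N.tolled → ℝ)) : Prop :=
  ∃ F : Set ((N.tolled → ℝ) × ℝ),
    Convex ℝ F ∧ IsExtreme ℝ (N.epigraph o d) F ∧
    ((0, 1) : (N.tolled → ℝ) × ℝ) ∉ (affineSpan ℝ F).direction ∧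
    W = {w | ∃ z : ℝ, (w, z) ∈ F}

/-- `w` is strongly bilevel feasible: `{w}` is a reaction set. -/
def StronglyBilevelFeasible {V A K : Type*} [DecidableEq V] [Fintype A] [Fintype K]
    (N : TollNetwork V A) (o d : K → V) (w : N.tolled → ℝ) : Prop :=
  N.IsReactionSet o d {w}

/-- `w` is strongly bilevel feasible for the single-commodity problem of the commodity `k`. -/
def StronglyBilevelFeasibleFor {V A K : Type*} [DecidableEq V] [Fintype A]
    (N : TollNetwork V A) (o d : K → V) (k : K) (w : N.tolled → ℝ) : Prop :=
  N.StronglyBilevelFeasible (fun _ : Unit => o k) (fun _ : Unit => d k) w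

/-- A composition `(w^k)` is bilevel feasible: `g(∑ w^k) = ∑ g^k(w^k)`. -/
def BilevelFeasibleComposition {V A K : Type*} [DecidableEq V] [Fintype A] [Fintype K]
    (N : TollNetwork V A) (o d : K → V) (wk : K → N.tolled → ℝ) : Prop :=
  N.conjugateCost o d (∑ k, wk k) = ∑ k, N.conjugateCostOf o d k (wk k)

/-- `(w^k)` is a bilevel feasible decomposition of `w`. -/
def IsBilevelFeasibleDecomposition {V A K : Type*} [DecidableEq V] [Fintype A] [Fintype K]
    (N : TollNetwork V A) (o d : K → V) (w : N.tolled → ℝ) (wk : K → N.tolled → ℝ) : Prop :=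
  w = ∑ k, wk k ∧ N.BilevelFeasibleComposition o d wk

end TollNetwork

/-- **Farkas' lemma** for finitely many linear functionals: a functional that is nonnegative wherever
all `A i` are nonnegative is a nonnegative combination of the `A i`. -/
theorem LinearMap.exists_nonneg_combination_of_forall_nonneg {W ι : Type*} [AddCommGroup W]
    [Module ℝ W] (s : Finset ι) (A : ι → W →ₗ[ℝ] ℝ) (γ : W →ₗ[ℝ] ℝ)
    (h : ∀ x, (∀ i ∈ s, 0 ≤ A i x) → 0 ≤ γ x) :
    ∃ l : ι → ℝ, (∀ i, 0 ≤ l i) ∧ γ = ∑ i ∈ s, l i • A i := by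
  classical
  induction s using Finset.induction_on generalizing A γ with
  | empty =>
    refine ⟨0, fun _ => le_rfl, ?_⟩
    ext x
    have h1 := h x (by simp)
    have h2 := h (-x) (by simp)
    rw [map_neg] at h2
    simp only [Finset.sum_empty, LinearMap.zero_apply]
    linarith
  | insert m s hm ih =>
    by_cases hs : ∀ x, (∀ i ∈ s, 0 ≤ A i x) → 0 ≤ γ x
    · obtain ⟨l, hl, e⟩ := ih A γ hs
      refine ⟨Function.update l m 0, fun i => ?_, ?_⟩
      · by_cases hi : i = m
        · simp [hi]
        · simpa [hi] using hl i
      · rw [Finset.sum_insert hm, e, Function.update_self, zero_smul, zero_add]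
        refine Finset.sum_congr rfl fun i hi => ?_
        rw [Function.update_of_ne (ne_of_mem_of_not_mem hi hm)]
    · push Not at hs
      obtain ⟨x₀, hx₀, hγ⟩ := hs
      have hα : A m x₀ < 0 := by
        by_contra hα
        push Not at hα
        exact absurd (h x₀ (by simpa using ⟨hα, hx₀⟩)) (not_le.2 hγ)
      obtain ⟨l, hl, e⟩ := ih (fun i => A i - (A i x₀ / A m x₀) • A m)
        (γ - (γ x₀ / A m x₀) • A m) (by
          intro x hx
          have hy := h (x - (A m x / A m x₀) • x₀) (by
            intro i hi
            rcases Finset.mem_insert.1 hi with rfl | hi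
            · simp [hα.ne]
            · have := hx i hi
              simp only [LinearMap.sub_apply, LinearMap.smul_apply, smul_eq_mul, map_sub,
                map_smul] at this ⊢
              convert this using 2
              ring)
          simp only [LinearMap.sub_apply, LinearMap.smul_apply, smul_eq_mul, map_sub,
            map_smul] at hy ⊢
          convert hy using 2
          ring)
      have hc : 0 ≤ γ x₀ / A m x₀ - ∑ i ∈ s, l i * (A i x₀ / A m x₀) := by
        have h1 : 0 ≤ γ x₀ / A m x₀ := div_nonneg_of_nonpos hγ.le hα.le
        have h2 : ∑ i ∈ s, l i * (A i x₀ / A m x₀) ≤ 0 := Finset.sum_nonpos fun i hi =>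
          mul_nonpos_of_nonneg_of_nonpos (hl i) (div_nonpos_of_nonneg_of_nonpos (hx₀ i hi) hα.le)
        linarith
      refine ⟨Function.update l m (γ x₀ / A m x₀ - ∑ i ∈ s, l i * (A i x₀ / A m x₀)),
        fun i => ?_, ?_⟩
      · by_cases hi : i = m
        · subst hi; simpa using hc
        · simpa [hi] using hl i
      · rw [Finset.sum_insert hm, Function.update_self]
        have : ∀ i ∈ s, Function.update l m (γ x₀ / A m x₀ -
            ∑ i ∈ s, l i * (A i x₀ / A m x₀)) i • A i = l i • A i := fun i hi => by
          rw [Function.update_of_ne (ne_of_mem_of_not_mem hi hm)]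
        rw [Finset.sum_congr rfl this]
        refine (sub_eq_iff_eq_add.1 e).trans ?_
        ext x
        simp only [LinearMap.add_apply, LinearMap.sum_apply, LinearMap.smul_apply,
          LinearMap.sub_apply, smul_eq_mul, mul_sub, sub_mul, Finset.sum_sub_distrib,
          Finset.sum_mul, mul_assoc]
        ring

namespace TollNetwork

open Classical in
/-- The extension of a toll vector to all arcs by zero. -/
noncomputable def extendToll {V A : Type*} (N : TollNetwork V A) : (N.tolled → ℝ) →ₗ[ℝ] A → ℝ where
  toFun t a := if h : a ∈ N.tolled then t ⟨a, h⟩ else 0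
  map_add' s t := by ext a; by_cases h : a ∈ N.tolled <;> simp [h]
  map_smul' r t := by ext a; by_cases h : a ∈ N.tolled <;> simp [h]

theorem extendToll_dotProduct {V A : Type*} [Fintype A] (N : TollNetwork V A) (t : N.tolled → ℝ) 
    (x : A → ℝ) :
    N.extendToll t ⬝ᵥ x = ∑ a : N.tolled, t a * x a := by
  classical
  have : ∀ a : N.tolled, t a * x a = N.extendToll t a * x a := fun a => by simp [extendToll]
  rw [Finset.sum_congr rfl fun a _ => this a,
    Finset.sum_coe_sort N.tolled fun a => N.extendToll t a * x a, dotProduct]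
  refine (Finset.sum_subset (Finset.subset_univ _) fun a _ ha => ?_).symm
  simp [extendToll, ha]

section Duality

variable {V A K : Type*} [DecidableEq V] [Fintype A] [Fintype K] (N : TollNetwork V A) (o d : K → V)

variable {N o d}

theorem le_followerCost {t : N.tolled → ℝ} (ht : 0 ≤ t) {r : ℝ}
    (h : ∀ p ∈ N.aggregatedFeasible o d, r ≤ (∑ k, N.cost ⬝ᵥ p.2 k) + t ⬝ᵥ p.1) :
    (r : EReal) ≤ N.followerCost o d t := by
  rw [followerCost, if_pos ht]
  exact le_iInf₂ fun p hp => EReal.coe_le_coe_iff.2 (h p hp)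

theorem nonneg_of_sum_le {x : K → A → ℝ} (hx : x ∈ N.reactions o d) {w : N.tolled → ℝ}
    (h : ∀ a : N.tolled, ∑ k, x k a ≤ w a) : 0 ≤ w :=
  fun a => (Finset.sum_nonneg fun k _ => (hx k).2 a).trans (h a)

theorem conjugateCost_le {x : K → A → ℝ} (hx : x ∈ N.reactions o d) {w : N.tolled → ℝ}
    (h : ∀ a : N.tolled, ∑ k, x k a ≤ w a) :
    N.conjugateCost o d w ≤ ((∑ k, N.cost ⬝ᵥ x k : ℝ) : EReal) := by
  refine iSup_le fun t => ?_
  by_cases ht : 0 ≤ t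
  · refine EReal.sub_le_of_le_add ?_
    rw [followerCost, if_pos ht, ← EReal.coe_add]
    exact iInf₂_le (w, x) ⟨nonneg_of_sum_le hx h, hx, h⟩
  · rw [followerCost, if_neg ht]
    simp

theorem dual_value_le {w : N.tolled → ℝ} {s : ℝ} (hs : N.conjugateCost o d w ≤ s)
    {π : K → V → ℝ} [Fintype V] {τ : N.tolled → ℝ} (hτ : 0 ≤ τ)
    (h : ∀ k a, 0 ≤ (π k ᵥ* N.incidence) a + N.extendToll τ a + N.cost a) :
    - (∑ k, π k ⬝ᵥ sourceSink (o k) (d k)) - τ ⬝ᵥ w ≤ s := by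
  have hf : ((- ∑ k, π k ⬝ᵥ sourceSink (o k) (d k) : ℝ) : EReal) ≤ N.followerCost o d τ := by
    refine le_followerCost hτ fun p hp => ?_
    have h1 : ∑ k, N.extendToll τ ⬝ᵥ p.2 k ≤ τ ⬝ᵥ p.1 := by
      simp only [extendToll_dotProduct]
      rw [Finset.sum_comm]
      refine Finset.sum_le_sum fun a _ => ?_
      rw [← Finset.mul_sum]
      exact mul_le_mul_of_nonneg_left (hp.2.2 a) (hτ a)
    have h2 : 0 ≤ ∑ k, (π k ᵥ* N.incidence + N.extendToll τ + N.cost) ⬝ᵥ p.2 k :=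
      Finset.sum_nonneg fun k _ => Finset.sum_nonneg fun a _ =>
        mul_nonneg (h k a) ((hp.2.1 k).2 a)
    have h3 : ∀ k, (π k ᵥ* N.incidence) ⬝ᵥ p.2 k = π k ⬝ᵥ sourceSink (o k) (d k) := fun k => by
      rw [← Matrix.dotProduct_mulVec, (hp.2.1 k).1]
    simp only [add_dotProduct, Finset.sum_add_distrib, h3] at h2
    linarith
  have := (EReal.sub_le_sub hf le_rfl).trans ((le_iSup (fun t : N.tolled → ℝ =>
    N.followerCost o d t - ((t ⬝ᵥ w : ℝ) : EReal)) τ).trans hs)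
  rw [← EReal.coe_sub] at this
  exact EReal.coe_le_coe_iff.1 this

theorem conjugateCost_nonneg (w : N.tolled → ℝ) : 0 ≤ N.conjugateCost o d w := by
  have hf : ((0 : ℝ) : EReal) ≤ N.followerCost o d 0 := by
    refine le_followerCost le_rfl fun p hp => ?_
    rw [zero_dotProduct, add_zero]
    exact Finset.sum_nonneg fun k _ => Finset.sum_nonneg fun a _ =>
      mul_nonneg (N.cost_nonneg a) ((hp.2.1 k).2 a)
  refine le_trans ?_ (le_iSup (fun t : N.tolled → ℝ =>
    N.followerCost o d t - ((t ⬝ᵥ w : ℝ) : EReal)) 0)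
  simpa using hf

variable (N) in
/-- The linear functionals on the dual variables `(π, τ, σ)` given by the columns of the
follower's problem: the flow, slack and objective-slack variables. -/
noncomputable def dualConstraint [Fintype V] :
    ((K × A) ⊕ (N.tolled ⊕ Unit)) → ((K → V → ℝ) × (N.tolled → ℝ) × ℝ) →ₗ[ℝ] ℝ
  | .inl (k, a) =>
    { toFun := fun p => (p.1 k ᵥ* N.incidence) a + N.extendToll p.2.1 a + N.cost a * p.2.2
      map_add' := fun p q => by simp [Matrix.add_vecMul]; ring
      map_smul' := fun r p => by simp [Matrix.smul_vecMul]; ring }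
  | .inr (.inl a) =>
    { toFun := fun p => p.2.1 a
      map_add' := fun p q => rfl
      map_smul' := fun r p => rfl }
  | .inr (.inr ()) =>
    { toFun := fun p => p.2.2
      map_add' := fun p q => rfl
      map_smul' := fun r p => rfl }

variable (o d) in
/-- The linear functional on the dual variables given by the right-hand side of the follower's
problem. -/
noncomputable def dualObjective [Fintype V] (w : N.tolled → ℝ) (s : ℝ) :
    ((K → V → ℝ) × (N.tolled → ℝ) × ℝ) →ₗ[ℝ] ℝ where
  toFun p := (∑ k, p.1 k ⬝ᵥ sourceSink (o k) (d k)) + p.2.1 ⬝ᵥ w + s * p.2.2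
  map_add' p q := by
    simp only [Prod.fst_add, Prod.snd_add, Pi.add_apply, add_dotProduct, Finset.sum_add_distrib]
    ring
  map_smul' r p := by
    simp only [Prod.smul_fst, Prod.smul_snd, Pi.smul_apply, smul_dotProduct, smul_eq_mul,
      RingHom.id_apply, ← Finset.mul_sum]
    ring

theorem dualObjective_nonneg [Fintype V] {w : N.tolled → ℝ} {s : ℝ}
    (hs : N.conjugateCost o d w ≤ s) (p : (K → V → ℝ) × (N.tolled → ℝ) × ℝ)
    (hp : ∀ i, 0 ≤ N.dualConstraint i p) : 0 ≤ dualObjective o d w s p := by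
  obtain ⟨π, τ, σ⟩ := p
  have h1 : ∀ k a, 0 ≤ (π k ᵥ* N.incidence) a + N.extendToll τ a + N.cost a * σ :=
    fun k a => hp (.inl (k, a))
  have h2 : 0 ≤ τ := fun a => hp (.inr (.inl a))
  have h3 : 0 ≤ σ := hp (.inr (.inr ()))
  have key : ∀ M : ℝ, 0 ≤ M → M * σ ≤ 1 →
      - (M * ∑ k, π k ⬝ᵥ sourceSink (o k) (d k)) - M * (τ ⬝ᵥ w) ≤ s := by
    intro M hM hMσ
    have := dual_value_le hs (π := M • π) (τ := M • τ) (smul_nonneg hM h2) (fun k a => by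
      have e1 := mul_nonneg hM (h1 k a)
      have e2 := mul_nonneg (N.cost_nonneg a) (sub_nonneg.2 hMσ)
      simp only [Pi.smul_apply, Matrix.smul_vecMul, map_smul, smul_eq_mul]
      linarith)
    simpa only [Pi.smul_apply, smul_dotProduct, smul_eq_mul, ← Finset.mul_sum] using this
  change 0 ≤ (∑ k, π k ⬝ᵥ sourceSink (o k) (d k)) + τ ⬝ᵥ w + s * σ
  generalize (∑ k, π k ⬝ᵥ sourceSink (o k) (d k)) = P at key ⊢
  generalize τ ⬝ᵥ w = T at key ⊢
  rcases h3.eq_or_lt with h0 | h0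
  · subst h0
    by_contra hneg
    push Not at hneg
    have hq : 0 < -(P + T) := by linarith
    have := key ((|s| + 1) / -(P + T)) (by positivity) (by simp)
    have e : (|s| + 1) / -(P + T) * -(P + T) = |s| + 1 := div_mul_cancel₀ _ hq.ne'
    linarith [le_abs_self s]
  · have := key σ⁻¹ (by positivity) (by rw [inv_mul_cancel₀ h0.ne'])
    have := mul_le_mul_of_nonneg_left this h0.le
    have e : σ * (-(σ⁻¹ * P) - σ⁻¹ * T) = - P - T := by field_simp
    linarith

/-- Strong duality with attainment for the follower's problem. -/
theorem mem_epigraph_iff [Fintype V] {w : N.tolled → ℝ} {s : ℝ} :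
    (w, s) ∈ N.epigraph o d ↔ ∃ x ∈ N.reactions o d, (∀ a : N.tolled, ∑ k, x k a ≤ w a) ∧
      ∑ k, N.cost ⬝ᵥ x k ≤ s := by
  classical
  constructor
  · intro hs
    obtain ⟨l, hl, e⟩ := LinearMap.exists_nonneg_combination_of_forall_nonneg Finset.univ
      N.dualConstraint (dualObjective o d w s)
      (fun p hp => dualObjective_nonneg hs p fun i => hp i (Finset.mem_univ i))
    have ev : ∀ (π : K → V → ℝ) (τ : N.tolled → ℝ) (σ : ℝ),
        (∑ k, π k ⬝ᵥ sourceSink (o k) (d k)) + τ ⬝ᵥ w + s * σ =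
        (∑ k, ∑ a, l (.inl (k, a)) *
          ((π k ᵥ* N.incidence) a + N.extendToll τ a + N.cost a * σ)) +
        (∑ a, l (.inr (.inl a)) * τ a) + l (.inr (.inr ())) * σ := by
      intro π τ σ
      have := LinearMap.congr_fun e (π, τ, σ)
      rw [LinearMap.sum_apply, Fintype.sum_sum_type, Fintype.sum_sum_type,
        Fintype.sum_prod_type] at this
      simpa [dualObjective, dualConstraint, add_assoc] using this
    refine ⟨fun k a => l (.inl (k, a)), fun k => ⟨?_, fun a => hl _⟩, fun a => ?_, ?_⟩
    · ext v
      have := ev (Pi.single k (Pi.single v 1)) 0 0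
      simp only [zero_dotProduct, mul_zero, add_zero, map_zero, Pi.zero_apply,
        Finset.sum_const_zero] at this
      rw [Finset.sum_eq_single k (by intro j _ hj; simp [hj]) (by simp),
        Finset.sum_eq_single k (by intro j _ hj; simp [hj]) (by simp)] at this
      simp only [Pi.single_eq_same, single_one_dotProduct, Matrix.single_one_vecMul] at this
      rw [this, Matrix.mulVec, dotProduct]
      exact Finset.sum_congr rfl fun a _ => mul_comm _ _
    · have := ev 0 (Pi.single a 1) 0
      have e2 : ∀ k, ∑ b, l (.inl (k, b)) * N.extendToll (Pi.single a 1) b = l (.inl (k, a)) := by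
        intro k
        have := N.extendToll_dotProduct (Pi.single a 1) (fun b => l (.inl (k, b)))
        rw [dotProduct_comm] at this
        simpa [dotProduct, Pi.single_apply] using this
      simp only [Pi.zero_apply, zero_dotProduct, Finset.sum_const_zero, Matrix.zero_vecMul, mul_zero,
        add_zero, zero_add, single_one_dotProduct, e2] at this
      have e3 : ∑ b, l (.inr (.inl b)) * (Pi.single a 1 : N.tolled → ℝ) b = l (.inr (.inl a)) := by
        simp [Pi.single_apply]
      rw [e3] at this
      linarith [hl (.inr (.inl a))]
    · have := ev 0 0 1
      simp only [Pi.zero_apply, zero_dotProduct, Finset.sum_const_zero, Matrix.zero_vecMul, mul_zero,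
        add_zero, zero_add, map_zero, mul_one] at this
      rw [this]
      have e4 : ∀ k, N.cost ⬝ᵥ (fun a => l (.inl (k, a))) = ∑ a, l (.inl (k, a)) * N.cost a :=
        fun k => dotProduct_comm _ _
      simp only [e4]
      linarith [hl (.inr (.inr ()))]
  · rintro ⟨x, hx, h1, h2⟩
    exact (conjugateCost_le hx h1).trans (EReal.coe_le_coe_iff.2 h2)

end Duality

end TollNetwork

/-- Extreme points of a finite Minkowski sum `S` of convex sets `P k`: the points with exactly one
decomposition, whose summands are all extreme. -/
theorem mem_extremePoints_iff_existsUnique_sum {K E : Type*} [Fintype K] [AddCommGroup E]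
    [Module ℝ E] {P : K → Set E} (hP : ∀ k, Convex ℝ (P k)) {S : Set E}
    (hS : ∀ p, p ∈ S ↔ ∃ q : K → E, (∀ k, q k ∈ P k) ∧ ∑ k, q k = p) (p : E) :
    p ∈ S.extremePoints ℝ ↔ (∃! q : K → E, (∀ k, q k ∈ P k) ∧ ∑ k, q k = p) ∧
      ∀ q : K → E, (∀ k, q k ∈ P k) → ∑ k, q k = p → ∀ k, q k ∈ (P k).extremePoints ℝ := by
  classical
  constructor
  · intro hp
    rw [mem_extremePoints_iff_left] at hp
    have swap : ∀ q : K → E, (∀ k, q k ∈ P k) → ∑ k, q k = p → ∀ k, ∀ a ∈ P k,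
        p - q k + a ∈ S := by
      intro q hq hqp k a ha
      refine (hS _).2 ⟨Function.update q k a, fun j => ?_, ?_⟩
      · by_cases hj : j = k
        · subst hj; simpa using ha
        · simpa [hj] using hq j
      · rw [Finset.sum_update_of_mem (Finset.mem_univ k), ← hqp,
          ← Finset.add_sum_erase _ _ (Finset.mem_univ k), Finset.sdiff_singleton_eq_erase]
        abel
    obtain ⟨q, hq, hqp⟩ := (hS p).1 hp.1
    refine ⟨⟨q, ⟨hq, hqp⟩, fun r hr => ?_⟩, fun q hq hqp k => ?_⟩
    · ext1 k
      have := hp.2 _ (swap q hq hqp k (r k) (hr.1 k)) _ (swap r hr.1 hr.2 k (q k) (hq k))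
        ⟨1 / 2, 1 / 2, by norm_num, by norm_num, by norm_num, by module⟩
      rw [sub_add_eq_add_sub, sub_eq_iff_eq_add] at this
      exact add_left_cancel this
    · rw [mem_extremePoints_iff_left]
      refine ⟨hq k, fun a ha b hb ⟨s, t, hs, ht, hst, e⟩ => ?_⟩
      have := hp.2 _ (swap q hq hqp k a ha) _ (swap q hq hqp k b hb)
        ⟨s, t, hs, ht, hst, by
          rw [smul_add, smul_add, add_add_add_comm, e, ← add_smul, hst, one_smul, sub_add_cancel]⟩
      rw [sub_add_eq_add_sub, sub_eq_iff_eq_add] at this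
      exact add_left_cancel this
  · rintro ⟨⟨q, ⟨hq, hqp⟩, hu⟩, hext⟩
    rw [mem_extremePoints_iff_left]
    refine ⟨(hS p).2 ⟨q, hq, hqp⟩, fun a ha b hb ⟨s, t, hs, ht, hst, e⟩ => ?_⟩
    obtain ⟨α, hα, rfl⟩ := (hS a).1 ha
    obtain ⟨β, hβ, rfl⟩ := (hS b).1 hb
    have h1 := hu (fun k => s • α k + t • β k)
      ⟨fun k => hP k (hα k) (hβ k) hs.le ht.le hst, by
        rw [← e, Finset.sum_add_distrib, Finset.smul_sum, Finset.smul_sum]⟩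
    rw [← hqp]
    refine Finset.sum_congr rfl fun k _ => ?_
    exact (mem_extremePoints_iff_left.1 (hext q hq hqp k)).2 _ (hα k) _ (hβ k)
      ⟨s, t, hs, ht, hst, congrFun h1 k⟩

theorem EReal.coe_finset_sum {ι : Type*} (s : Finset ι) (f : ι → ℝ) :
    ((∑ i ∈ s, f i : ℝ) : EReal) = ∑ i ∈ s, (f i : EReal) :=
  map_sum (⟨⟨Real.toEReal, EReal.coe_zero⟩, EReal.coe_add⟩ : ℝ →+ EReal) f s

namespace TollNetwork

section Extreme

variable {V A K : Type*} [DecidableEq V] [Fintype A] [Fintype K] {N : TollNetwork V A}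
  {o d : K → V}

theorem stronglyBilevelFeasible_iff {w : N.tolled → ℝ} :
    N.StronglyBilevelFeasible o d w ↔ ∃ z : ℝ, (w, z) ∈ (N.epigraph o d).extremePoints ℝ := by
  constructor
  · rintro ⟨F, -, hF, hdir, hW⟩
    obtain ⟨z, hz⟩ : w ∈ {w | ∃ z : ℝ, (w, z) ∈ F} := hW ▸ rfl
    refine ⟨z, isExtreme_singleton.1 ?_⟩
    convert hF
    refine (Set.eq_singleton_iff_unique_mem.2 ⟨hz, ?_⟩).symm
    rintro ⟨w', z'⟩ h'
    obtain rfl : w' = w := by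
      have : w' ∈ {w | ∃ z : ℝ, (w, z) ∈ F} := ⟨z', h'⟩
      rwa [← hW] at this
    by_contra hne
    have hne : z' - z ≠ 0 := fun h0 => hne (by rw [sub_eq_zero.1 h0])
    refine hdir ?_
    have := Submodule.smul_mem _ (z' - z)⁻¹ (AffineSubspace.vsub_mem_direction
      (subset_affineSpan ℝ F h') (subset_affineSpan ℝ F hz))
    simpa [hne] using this
  · rintro ⟨z, hz⟩
    refine ⟨{(w, z)}, convex_singleton _, isExtreme_singleton.2 hz, ?_, ?_⟩
    · simp [direction_affineSpan]
    · ext w'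
      simp

theorem conjugateCost_eq_of_mem_extremePoints {w : N.tolled → ℝ} {z : ℝ}
    (h : (w, z) ∈ (N.epigraph o d).extremePoints ℝ) : N.conjugateCost o d w = z := by
  rw [mem_extremePoints_iff_left] at h
  have hle : N.conjugateCost o d w ≤ z := h.1
  refine hle.antisymm (not_lt.1 fun hlt => ?_)
  obtain ⟨y, hy, hyz⟩ := EReal.lt_iff_exists_real_btwn.1 hlt
  have hyz : y < z := EReal.coe_lt_coe_iff.1 hyz
  have := h.2 (w, y) hy.le (w, 2 * z - y)
    (hle.trans (EReal.coe_le_coe_iff.2 (by linarith)))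
    ⟨1 / 2, 1 / 2, by norm_num, by norm_num, by norm_num, by
      ext
      · simp; ring
      · simp; ring⟩
  exact hyz.ne (Prod.ext_iff.1 this).2

theorem convex_epigraph [Fintype V] : Convex ℝ (N.epigraph o d) := by
  rintro ⟨w, z⟩ h ⟨w', z'⟩ h' s t hs ht hst
  obtain ⟨x, hx, h1, h2⟩ := mem_epigraph_iff.1 h
  obtain ⟨x', hx', h1', h2'⟩ := mem_epigraph_iff.1 h'
  refine mem_epigraph_iff.2 ⟨s • x + t • x', fun k => ⟨?_, ?_⟩, fun a => ?_, ?_⟩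
  · simp only [Pi.add_apply, Pi.smul_apply, Matrix.mulVec_add, Matrix.mulVec_smul, (hx k).1,
      (hx' k).1]
    rw [← add_smul, hst, one_smul]
  · exact add_nonneg (smul_nonneg hs (hx k).2) (smul_nonneg ht (hx' k).2)
  · simp only [Pi.add_apply, Pi.smul_apply, smul_eq_mul, Finset.sum_add_distrib, ← Finset.mul_sum]
    exact add_le_add (mul_le_mul_of_nonneg_left (h1 a) hs) (mul_le_mul_of_nonneg_left (h1' a) ht)
  · simp only [Pi.add_apply, Pi.smul_apply, smul_eq_mul, dotProduct_add, dotProduct_smul,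
      Finset.sum_add_distrib, ← Finset.mul_sum]
    exact add_le_add (mul_le_mul_of_nonneg_left h2 hs) (mul_le_mul_of_nonneg_left h2' ht)

variable (N o d) in
/-- The epigraph of the single-commodity function `g^k`. -/
def epigraphOf (k : K) : Set ((N.tolled → ℝ) × ℝ) :=
  N.epigraph (fun _ : Unit => o k) (fun _ : Unit => d k)

omit [Fintype K] in
theorem mem_epigraphOf_iff [Fintype V] {k : K} {p : (N.tolled → ℝ) × ℝ} :
    p ∈ N.epigraphOf o d k ↔ ∃ x : A → ℝ,
      (N.incidence *ᵥ x = sourceSink (o k) (d k) ∧ 0 ≤ x) ∧ (∀ a : N.tolled, x a ≤ p.1 a) ∧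
      N.cost ⬝ᵥ x ≤ p.2 := by
  rw [epigraphOf, ← Prod.mk.eta (p := p), mem_epigraph_iff]
  constructor
  · rintro ⟨x, hx, h1, h2⟩
    exact ⟨x (), hx (), by simpa using h1, by simpa using h2⟩
  · rintro ⟨x, hx, h1, h2⟩
    exact ⟨fun _ => x, fun _ => hx, by simpa using h1, by simpa using h2⟩

theorem sum_mem_epigraph [Fintype V] {q : K → (N.tolled → ℝ) × ℝ}
    (hq : ∀ k, q k ∈ N.epigraphOf o d k) : ∑ k, q k ∈ N.epigraph o d := by
  choose x hx h1 h2 using fun k => mem_epigraphOf_iff.1 (hq k)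
  rw [← Prod.mk.eta (p := ∑ k, q k), mem_epigraph_iff, Prod.fst_sum, Prod.snd_sum]
  refine ⟨x, hx, fun a => ?_, Finset.sum_le_sum fun k _ => h2 k⟩
  rw [Finset.sum_apply]
  exact Finset.sum_le_sum fun k _ => h1 k a

/-- The epigraph of `g` is the Minkowski sum of the epigraphs of the `g^k`. -/
theorem mem_epigraph_iff_exists_sum [Fintype V] [Nonempty K] (p : (N.tolled → ℝ) × ℝ) :
    p ∈ N.epigraph o d ↔ ∃ q : K → (N.tolled → ℝ) × ℝ, (∀ k, q k ∈ N.epigraphOf o d k) ∧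
      ∑ k, q k = p := by
  classical
  constructor
  · intro hp
    obtain ⟨x, hx, h1, h2⟩ := mem_epigraph_iff.1 hp
    let r : K → (N.tolled → ℝ) × ℝ := fun k => (fun a => x k a, N.cost ⬝ᵥ x k)
    have hr : 0 ≤ p - ∑ k, r k := by
      rw [sub_nonneg, Prod.le_def, Prod.fst_sum, Prod.snd_sum]
      refine ⟨fun a => ?_, h2⟩
      rw [Finset.sum_apply]
      exact h1 a
    obtain ⟨k₀⟩ := ‹Nonempty K›
    refine ⟨r + Pi.single k₀ (p - ∑ k, r k), fun k => ?_, ?_⟩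
    · have h0 : 0 ≤ (Pi.single k₀ (p - ∑ k, r k) : K → (N.tolled → ℝ) × ℝ) k :=
        (Pi.single_nonneg (i := k₀).2 hr : (0 : K → (N.tolled → ℝ) × ℝ) ≤ _) k
      exact mem_epigraphOf_iff.2 ⟨x k, hx k, fun a => le_add_of_nonneg_right (h0.1 a),
        le_add_of_nonneg_right h0.2⟩
    · simp only [Pi.add_apply, Finset.sum_add_distrib, Finset.sum_pi_single', Finset.mem_univ, if_true, add_sub_cancel]
  · rintro ⟨q, hq, rfl⟩
    exact sum_mem_epigraph hq

theorem IsBilevelFeasibleDecomposition.exists_real {w : N.tolled → ℝ} {z : ℝ}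
    (hz : N.conjugateCost o d w = z) {wk : K → N.tolled → ℝ}
    (h : N.IsBilevelFeasibleDecomposition o d w wk) :
    ∃ y : K → ℝ, (∀ k, N.conjugateCostOf o d k (wk k) = y k) ∧ ∑ k, (wk k, y k) = (w, z) := by
  obtain ⟨rfl, h⟩ := h
  rw [BilevelFeasibleComposition, hz] at h
  have hne : ∀ k, N.conjugateCostOf o d k (wk k) ≠ ⊤ := fun k hk => by
    have := Finset.single_le_sum (f := fun k => N.conjugateCostOf o d k (wk k))
      (fun k _ => conjugateCost_nonneg _) (Finset.mem_univ k)
    rw [← h, hk, top_le_iff] at this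
    exact EReal.coe_ne_top z this
  have hy : ∀ k, N.conjugateCostOf o d k (wk k) =
      ((N.conjugateCostOf o d k (wk k)).toReal : EReal) := fun k =>
    (EReal.coe_toReal (hne k)
      (ne_of_gt (lt_of_lt_of_le EReal.bot_lt_zero (conjugateCost_nonneg _)))).symm
  refine ⟨_, hy, Prod.ext ?_ ?_⟩
  · simp [Prod.fst_sum]
  · rw [Finset.sum_congr rfl fun k _ => hy k, ← EReal.coe_finset_sum] at h
    simpa [Prod.snd_sum] using (EReal.coe_injective h).symm

theorem conjugateCostOf_eq_snd [Fintype V] {w : N.tolled → ℝ} {z : ℝ}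
    (hz : N.conjugateCost o d w = z) {q : K → (N.tolled → ℝ) × ℝ}
    (hq : ∀ k, q k ∈ N.epigraphOf o d k) (hs : ∑ k, q k = (w, z)) (k : K) :
    N.conjugateCostOf o d k (q k).1 = (q k).2 := by
  have hle : ∀ k, N.conjugateCostOf o d k (q k).1 ≤ (q k).2 := hq
  have hfin : ∀ k, ∃ y : ℝ, N.conjugateCostOf o d k (q k).1 = y := fun k =>
    ⟨_, (EReal.coe_toReal (ne_of_lt ((hle k).trans_lt (EReal.coe_lt_top _)))
      (ne_of_gt (lt_of_lt_of_le EReal.bot_lt_zero (conjugateCost_nonneg _)))).symm⟩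
  choose y hy using hfin
  have hyq : ∀ k ∈ Finset.univ, y k ≤ (q k).2 := fun k _ =>
    EReal.coe_le_coe_iff.1 (hy k ▸ hle k)
  have hmem : ∑ k, ((q k).1, y k) ∈ N.epigraph o d := sum_mem_epigraph fun k => (hy k).le
  have hzy : z ≤ ∑ k, y k := by
    have e : ∑ k, ((q k).1, y k) = (w, ∑ k, y k) :=
      Prod.ext (by simp only [Prod.fst_sum, ← Prod.fst_sum (f := q), hs]) Prod.snd_sum
    rw [e] at hmem
    exact EReal.coe_le_coe_iff.1 (hz ▸ hmem : (z : EReal) ≤ _)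
  have hqz : ∑ k, (q k).2 = z := by rw [← Prod.snd_sum, hs]
  rw [hy, (Finset.sum_eq_sum_iff_of_le hyq).1
    ((Finset.sum_le_sum hyq).antisymm (hqz.le.trans hzy)) k (Finset.mem_univ k)]

theorem isBilevelFeasibleDecomposition_fst [Fintype V] {w : N.tolled → ℝ} {z : ℝ}
    (hz : N.conjugateCost o d w = z) {q : K → (N.tolled → ℝ) × ℝ}
    (hq : ∀ k, q k ∈ N.epigraphOf o d k) (hs : ∑ k, q k = (w, z)) :
    N.IsBilevelFeasibleDecomposition o d w fun k => (q k).1 := by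
  have e1 : ∑ k, (q k).1 = w := by rw [← Prod.fst_sum, hs]
  refine ⟨e1.symm, ?_⟩
  rw [BilevelFeasibleComposition, e1, hz,
    Finset.sum_congr rfl fun k _ => conjugateCostOf_eq_snd hz hq hs k, ← EReal.coe_finset_sum,
    ← Prod.snd_sum, hs]

theorem stronglyBilevelFeasible_iff_of_nonempty [Fintype V] [Nonempty K] (w : N.tolled → ℝ) :
    N.StronglyBilevelFeasible o d w ↔
      (∃! wk : K → N.tolled → ℝ, N.IsBilevelFeasibleDecomposition o d w wk) ∧
      (∀ wk : K → N.tolled → ℝ, N.IsBilevelFeasibleDecomposition o d w wk →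
        ∀ k, N.StronglyBilevelFeasibleFor o d k (wk k)) := by
  have hmink := mem_extremePoints_iff_existsUnique_sum (P := N.epigraphOf o d)
    (fun k => convex_epigraph) (mem_epigraph_iff_exists_sum (N := N) (o := o) (d := d))
  rw [stronglyBilevelFeasible_iff]
  constructor
  · rintro ⟨z, hz⟩
    have hgz := conjugateCost_eq_of_mem_extremePoints hz
    obtain ⟨⟨q, ⟨hq, hqs⟩, hu⟩, hext⟩ := (hmink _).1 hz
    refine ⟨⟨fun k => (q k).1, isBilevelFeasibleDecomposition_fst hgz hq hqs, fun wk hwk => ?_⟩,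
      fun wk hwk k => ?_⟩
    all_goals obtain ⟨y, hy, hys⟩ := hwk.exists_real hgz
    · rw [← hu (fun k => (wk k, y k)) ⟨fun k => (hy k).le, hys⟩]
    · exact stronglyBilevelFeasible_iff.2
        ⟨y k, hext (fun k => (wk k, y k)) (fun k => (hy k).le) hys k⟩
  · rintro ⟨⟨wk, hwk, hu⟩, hext⟩
    choose y hy using fun k => stronglyBilevelFeasible_iff.1 (hext wk hwk k)
    have hgy : ∀ k, N.conjugateCostOf o d k (wk k) = y k := fun k =>
      conjugateCost_eq_of_mem_extremePoints (hy k)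
    have hgz : N.conjugateCost o d w = ((∑ k, y k : ℝ) : EReal) := by
      rw [hwk.1, hwk.2, Finset.sum_congr rfl fun k _ => hgy k, EReal.coe_finset_sum]
    have hsum : ∑ k, (wk k, y k) = (w, ∑ k, y k) := by
      rw [hwk.1]
      exact Prod.ext Prod.fst_sum Prod.snd_sum
    have huniq : ∀ q : K → (N.tolled → ℝ) × ℝ, (∀ k, q k ∈ N.epigraphOf o d k) →
        ∑ k, q k = (w, ∑ k, y k) → q = fun k => (wk k, y k) := by
      intro q hq hqs
      have e := hu _ (isBilevelFeasibleDecomposition_fst hgz hq hqs)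
      ext1 k
      have e1 : (q k).1 = wk k := congrFun e k
      refine Prod.ext e1 (EReal.coe_injective ?_)
      rw [← conjugateCostOf_eq_snd hgz hq hqs k, e1, hgy]
    refine ⟨∑ k, y k, (hmink _).2 ⟨⟨fun k => (wk k, y k), ⟨fun k => (hgy k).le, hsum⟩,
      fun q hq => huniq q hq.1 hq.2⟩, fun q hq hqs k => ?_⟩⟩
    rw [huniq q hq hqs]
    exact hy k

theorem mem_epigraph_iff_of_isEmpty [Fintype V] [IsEmpty K] {p : (N.tolled → ℝ) × ℝ} :
    p ∈ N.epigraph o d ↔ 0 ≤ p := by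
  rw [← Prod.mk.eta (p := p), mem_epigraph_iff]
  simp only [Finset.univ_eq_empty, Finset.sum_empty]
  exact ⟨fun ⟨_, _, h1, h2⟩ => ⟨h1, h2⟩, fun h => ⟨isEmptyElim, isEmptyElim, h.1, h.2⟩⟩

theorem mem_extremePoints_epigraph_iff_of_isEmpty [Fintype V] [IsEmpty K]
    {p : (N.tolled → ℝ) × ℝ} : p ∈ (N.epigraph o d).extremePoints ℝ ↔ p = 0 := by
  simp only [mem_extremePoints_iff_left, mem_epigraph_iff_of_isEmpty]
  constructor
  · rintro ⟨hp, h⟩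
    exact (h 0 le_rfl ((2 : ℝ) • p) (smul_nonneg zero_le_two hp)
      ⟨1 / 2, 1 / 2, by norm_num, by norm_num, by norm_num, by module⟩).symm
  · rintro rfl
    refine ⟨le_rfl, fun a ha b hb ⟨s, t, hs, ht, _, e⟩ => ?_⟩
    have h1 : s • a = 0 := le_antisymm
      (by rw [← e]; exact le_add_of_nonneg_right (smul_nonneg ht.le hb)) (smul_nonneg hs.le ha)
    exact (smul_eq_zero.1 h1).resolve_left hs.ne'

theorem stronglyBilevelFeasible_iff_of_isEmpty [Fintype V] [IsEmpty K] (w : N.tolled → ℝ) :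
    N.StronglyBilevelFeasible o d w ↔
      (∃! wk : K → N.tolled → ℝ, N.IsBilevelFeasibleDecomposition o d w wk) ∧
      (∀ wk : K → N.tolled → ℝ, N.IsBilevelFeasibleDecomposition o d w wk →
        ∀ k, N.StronglyBilevelFeasibleFor o d k (wk k)) := by
  rw [stronglyBilevelFeasible_iff]
  constructor
  · rintro ⟨z, hz⟩
    have hgz := conjugateCost_eq_of_mem_extremePoints hz
    obtain ⟨rfl, rfl⟩ := Prod.mk_eq_zero.1 (mem_extremePoints_epigraph_iff_of_isEmpty.1 hz)
    refine ⟨⟨isEmptyElim, ⟨by simp, ?_⟩, fun _ _ => Subsingleton.elim _ _⟩,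
      fun _ _ k => isEmptyElim k⟩
    simpa [BilevelFeasibleComposition] using hgz
  · rintro ⟨⟨wk, hwk, -⟩, -⟩
    exact ⟨0, mem_extremePoints_epigraph_iff_of_isEmpty.2
      (Prod.mk_eq_zero.2 ⟨by simpa using hwk.1, rfl⟩)⟩

end Extreme

end TollNetwork

theorem mainTheorem2 {V A K : Type*} [Fintype V] [DecidableEq V] [Fintype A] [Fintype K]
    (N : TollNetwork V A) (o d : K → V) (hpath : ∀ k, N.HasTollFreePath (o k) (d k))
    (w : N.tolled → ℝ) (hw : 0 ≤ w) :
    N.StronglyBilevelFeasible o d w ↔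
      (∃! wk : K → N.tolled → ℝ, N.IsBilevelFeasibleDecomposition o d w wk) ∧
      (∀ wk : K → N.tolled → ℝ, N.IsBilevelFeasibleDecomposition o d w wk →
        ∀ k, N.StronglyBilevelFeasibleFor o d k (wk k)) := by
  cases isEmpty_or_nonempty K
  · exact TollNetwork.stronglyBilevelFeasible_iff_of_isEmpty w
  · exact TollNetwork.stronglyBilevelFeasible_iff_of_nonempty w
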